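/- Let $n\ge 0$ be an integer and let $\mathrm{SO}_n\mathbb R=\{A\in M_n\mathbb R : AA^T=A^TA=I,\ \det A=1\}$, regarded as an embedded submanifold of $M_n\mathbb R$, of dimension $N=n(n-1)/2$, whose tangent space at $A$ is $T_A=A\,\mathfrak{so}_n\mathbb R$, where $\mathfrak{so}_n\mathbb R$ is the space of antisymmetric matrices. Equip each $T_A$ with the inner product $X\cdot Y=\tfrac12\operatorname{Tr}(X^TY)$. Let $\omega$ be a Riemannian volume form for this metric, that is, a smooth differential $N$-form on $\mathrm{SO}_n\mathbb R$ which takes values $\pm1$ on the orthonormal bases of each $T_A$; such forms exist. Let $d\omega$ be the associated positive Borel measure (the Riemannian measure), that is, the unique Borel measure on $\mathrm{SO}_n\mathbb R$ such that, for every smooth local parametrization $\varphi:U\to\mathrm{SO}_n\mathbb R$ (with $U\subseteq\mathbb R^N$ open) and every Borel set $S\subseteq U$, the measure of $\varphi(S)$ is $\int_S|\omega_{\varphi(u)}(\partial_1\varphi(u),\dots,\partial_N\varphi(u))|\,du$; this measure exists and is unique. Let $d\mu$ be a Haar measure on $\mathrm{SO}_n\mathbb R$. Then there exists a constant $C_n>0$,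 independent of the choice of $\omega$, such that $d\omega=C_n\,d\mu$. -/

import Mathlib

open MeasureTheory

noncomputable section

namespace RotationGroup

/-- The group `SO_n(ℝ)`, with the subspace topology of the space of real `n × n` matrices. -/
abbrev SO (n : ℕ) : Type := Matrix.specialOrthogonalGroup (Fin n) ℝ

/-- The Borel σ-algebra of `SO_n(ℝ)`. -/
instance instMeasurableSpaceSO (n : ℕ) : MeasurableSpace (SO n) := borel (SO n)

instance instBorelSpaceSO (n : ℕ) : BorelSpace (SO n) := ⟨rfl⟩

/-- The pairs `(i, j)` with `i < j`; they index coordinates on `SO_n(ℝ)`, whose dimension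
`n (n - 1) / 2` is the number of such pairs. -/
abbrev Pairs (n : ℕ) : Type := {p : Fin n × Fin n // p.1 < p.2}

/-- The inner product `A · B = ½ Tr (Aᵀ B)`. -/
def matInner {n : ℕ} (A B : Matrix (Fin n) (Fin n) ℝ) : ℝ :=
  (1 / 2 : ℝ) * (A.transpose * B).trace

/-- The space `𝔰𝔬_n` of antisymmetric matrices. -/
def antisymm (n : ℕ) : Submodule ℝ (Matrix (Fin n) (Fin n) ℝ) where
  carrier := {P | P.transpose = -P}
  add_mem' {P Q} hP hQ := by
    simp only [Set.mem_ofPred_eq] at hP hQ ⊢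
    rw [Matrix.transpose_add, hP, hQ, neg_add]
  zero_mem' := by simp
  smul_mem' c P hP := by
    simp only [Set.mem_ofPred_eq] at hP ⊢
    rw [Matrix.transpose_smul, hP, smul_neg]

/-- The tangent space `T_A = A 𝔰𝔬_n` of `SO_n(ℝ)` at `A`, as a subspace of the space of matrices. -/
def tangentSpace {n : ℕ} (A : SO n) : Submodule ℝ (Matrix (Fin n) (Fin n) ℝ) :=
  (antisymm n).map (LinearMap.mulLeft ℝ (A : Matrix (Fin n) (Fin n) ℝ))

/-- The partial derivative of a matrix-valued map in the coordinate direction `p`. -/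
def partialDeriv {n : ℕ} (f : (Pairs n → ℝ) → SO n) (p : Pairs n) (u : Pairs n → ℝ) :
    Matrix (Fin n) (Fin n) ℝ :=
  Matrix.of fun i j =>
    fderiv ℝ (fun v => (f v : Matrix (Fin n) (Fin n) ℝ) i j) u (Pi.single p 1)

/-- `e` is a smooth local parametrization (the inverse of a smooth chart) of the embedded
submanifold `SO_n(ℝ)` of the space of matrices: a homeomorphism of an open set of coordinates onto
an open subset of `SO_n(ℝ)` which is smooth as a matrix-valued map and is an immersion. -/
structure IsLocalParametrization {n : ℕ} (e : OpenPartialHomeomorph (Pairs n → ℝ) (SO n)) :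
    Prop where
  smooth : ∀ i j, ContDiffOn ℝ (⊤ : ℕ∞) (fun u => (e u : Matrix (Fin n) (Fin n) ℝ) i j) e.source
  immersion : ∀ u ∈ e.source, LinearIndependent ℝ (fun p => partialDeriv e p u)

/-- The partial derivatives of a local parametrization are tangent vectors. -/
theorem IsLocalParametrization.partialDeriv_mem {n : ℕ}
    {e : OpenPartialHomeomorph (Pairs n → ℝ) (SO n)} (he : IsLocalParametrization e)
    {u : Pairs n → ℝ} (hu : u ∈ e.source) (p : Pairs n) :
    partialDeriv e p u ∈ tangentSpace (e u) := by
  set A : Matrix (Fin n) (Fin n) ℝ := (e u : Matrix (Fin n) (Fin n) ℝ) with hA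
  set X := partialDeriv e p u with hX
  have hd : ∀ i j, DifferentiableAt ℝ (fun v => (e v : Matrix (Fin n) (Fin n) ℝ) i j) u :=
    fun i j => ((he.smooth i j).contDiffAt (e.open_source.mem_nhds hu)).differentiableAt (by simp)
  have horth : ∀ B : SO n, (B : Matrix (Fin n) (Fin n) ℝ).transpose * B = 1 := fun B => by
    simpa [Matrix.star_eq_conjTranspose] using
      Matrix.mem_unitaryGroup_iff'.1 (Matrix.mem_specialUnitaryGroup_iff.1 B.2).1
  have key : X.transpose * A + A.transpose * X = 0 := by
    ext i j
    have hc : (fun v => ∑ k, (e v : Matrix (Fin n) (Fin n) ℝ) k i *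
        (e v : Matrix (Fin n) (Fin n) ℝ) k j) =
        fun _ => (1 : Matrix (Fin n) (Fin n) ℝ) i j := by
      funext v
      rw [← horth (e v)]
      simp [Matrix.mul_apply]
    have h1 := HasFDerivAt.fun_sum (u := Finset.univ)
      (fun k _ => ((hd k i).hasFDerivAt.mul (hd k j).hasFDerivAt))
    have h2 := h1.unique ((hasFDerivAt_const ((1 : Matrix (Fin n) (Fin n) ℝ) i j)
      u).congr_of_eventuallyEq (Filter.Eventually.of_forall fun v => by simpa using congrFun hc v))
    have h3 := congrArg (fun L => L (Pi.single p 1)) h2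
    simp only [Matrix.add_apply, Matrix.mul_apply, Matrix.transpose_apply, Matrix.zero_apply,
      ← Finset.sum_add_distrib]
    simp only [sum_apply, add_apply,
      smul_apply, smul_eq_mul, zero_apply] at h3
    rw [← h3]
    refine Finset.sum_congr rfl fun k _ => ?_
    simp only [hX, hA, partialDeriv, Matrix.of_apply]
    ring
  refine ⟨A.transpose * X, ?_, ?_⟩
  · change (A.transpose * X).transpose = -(A.transpose * X)
    rw [Matrix.transpose_mul, Matrix.transpose_transpose]
    exact eq_neg_of_add_eq_zero_left key
  · have h : A * A.transpose = 1 := mul_eq_one_comm.1 (horth (e u))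
    simp [← hA, ← mul_assoc, h]

/-- A differential form of top degree on `SO_n(ℝ)` (not necessarily smooth): an alternating form
on each tangent space. Its arguments are labelled by the pairs `i < j`. -/
abbrev TopForm (n : ℕ) : Type :=
  ∀ A : SO n, tangentSpace A [⋀^Pairs n]→ₗ[ℝ] ℝ

open Classical in
/-- The coefficient of `ω` in the local coordinates given by `e`: its value on the coordinate
vector fields. It is only meaningful on `e.source`, and is put equal to `0` elsewhere. -/
def TopForm.coeff {n : ℕ} (ω : TopForm n) {e : OpenPartialHomeomorph (Pairs n → ℝ) (SO n)}
    (he : IsLocalParametrization e) (u : Pairs n → ℝ) : ℝ :=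
  if hu : u ∈ e.source then ω (e u) (fun p => ⟨partialDeriv e p u, he.partialDeriv_mem hu p⟩)
  else 0

/-- `ω` is a Riemannian volume form of `SO_n(ℝ)` (for one of the orientations) for the metric
`X · Y = ½ Tr (Xᵀ Y)` on tangent spaces: it is smooth, and takes the values `±1` on orthonormal
bases of the tangent spaces. -/
structure IsRiemannianVolumeForm {n : ℕ} (ω : TopForm n) : Prop where
  smooth : ∀ (e : OpenPartialHomeomorph (Pairs n → ℝ) (SO n)) (he : IsLocalParametrization e),
    ContDiffOn ℝ (⊤ : ℕ∞) (ω.coeff he) e.source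
  orthonormal : ∀ (A : SO n) (b : Pairs n → tangentSpace A),
    (∀ p q, matInner (b p : Matrix (Fin n) (Fin n) ℝ) (b q) = if p = q then 1 else 0) →
      |ω A b| = 1

/-- `ν` is the positive measure `dω` defined by the form `ω`: in all local coordinates it has the
density `|ω(∂_1, …, ∂_N)|` with respect to Lebesgue measure. -/
def IsMeasureOfForm {n : ℕ} (ω : TopForm n) (ν : Measure (SO n)) : Prop :=
  ∀ (e : OpenPartialHomeomorph (Pairs n → ℝ) (SO n)) (he : IsLocalParametrization e)
    (S : Set (Pairs n → ℝ)), MeasurableSet S → S ⊆ e.source →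
      ν (e '' S) = ∫⁻ u in S, ENNReal.ofReal |ω.coeff he u|

end RotationGroup

end

noncomputable section

namespace RotationGroup

/-- Real `n × n` matrices. -/
abbrev Mat (n : ℕ) : Type := Matrix (Fin n) (Fin n) ℝ

/-- The pairs `(i, j)` with `j ≤ i`; they index the entries of a lower triangular matrix. -/
abbrev LowPairs (n : ℕ) : Type := {p : Fin n × Fin n // ¬ p.1 < p.2}

/-- The space of entries of a matrix, split into those above the diagonal and the others. -/
abbrev Entries (n : ℕ) : Type := (Pairs n → ℝ) × (LowPairs n → ℝ)

/-- A matrix is determined by its entries above the diagonal and its other entries. -/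
def split (n : ℕ) : Mat n ≃ₗ[ℝ] Entries n where
  toFun M := (fun p => M p.1.1 p.1.2, fun q => M q.1.1 q.1.2)
  map_add' _ _ := rfl
  map_smul' _ _ := rfl
  invFun x := Matrix.of fun i j =>
    if h : i < j then x.1 ⟨(i, j), h⟩ else x.2 ⟨(i, j), h⟩
  left_inv M := by
    ext i j
    by_cases h : i < j <;> simp
  right_inv x := by
    refine Prod.ext ?_ ?_
    · funext p
      simp [p.2]
    · funext q
      have := q.2
      simp [this]

/-- The entries above the diagonal. -/
def upperEntries (n : ℕ) : Mat n →ₗ[ℝ] (Pairs n → ℝ) := LinearMap.fst ℝ _ _ ∘ₗ (split n).toLinearMap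

@[simp] theorem upperEntries_apply {n : ℕ} (M : Mat n) (p : Pairs n) :
    upperEntries n M p = M p.1.1 p.1.2 := rfl

/-- The lower triangular matrix with given entries. -/
def lowerMat (n : ℕ) : (LowPairs n → ℝ) →ₗ[ℝ] Mat n :=
  (split n).symm.toLinearMap ∘ₗ LinearMap.inr ℝ _ _

/-- The strictly upper triangular matrix with given entries. -/
def upperMat (n : ℕ) : (Pairs n → ℝ) →ₗ[ℝ] Mat n :=
  (split n).symm.toLinearMap ∘ₗ LinearMap.inl ℝ _ _

/-- The antisymmetric matrix with given entries above the diagonal. -/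
def skew (n : ℕ) : (Pairs n → ℝ) →ₗ[ℝ] Mat n :=
  upperMat n - (Matrix.transposeLinearEquiv (Fin n) (Fin n) ℝ ℝ).toLinearMap ∘ₗ upperMat n

theorem lowerMat_apply {n : ℕ} (l : LowPairs n → ℝ) (i j : Fin n) :
    lowerMat n l i j = if h : i < j then 0 else l ⟨(i, j), h⟩ := rfl

theorem upperMat_apply {n : ℕ} (w : Pairs n → ℝ) (i j : Fin n) :
    upperMat n w i j = if h : i < j then w ⟨(i, j), h⟩ else 0 := rfl

theorem skew_apply {n : ℕ} (w : Pairs n → ℝ) (i j : Fin n) :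
    skew n w i j = upperMat n w i j - upperMat n w j i := rfl

theorem transpose_skew {n : ℕ} (w : Pairs n → ℝ) : (skew n w).transpose = -skew n w := by
  ext i j
  simp [skew_apply]

theorem skew_mem {n : ℕ} (w : Pairs n → ℝ) : skew n w ∈ antisymm n := transpose_skew w

@[simp] theorem upperEntries_skew {n : ℕ} (w : Pairs n → ℝ) : upperEntries n (skew n w) = w := by
  funext p
  simp [skew_apply, upperMat_apply, p.2, not_lt_of_gt p.2]

theorem antisymm_apply {n : ℕ} {X : Mat n} (hX : X ∈ antisymm n) (i j : Fin n) :
    X i j = -X j i := by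
  have h : X.transpose = -X := hX
  simpa using congrFun (congrFun h j) i

theorem skew_upperEntries {n : ℕ} {X : Mat n} (hX : X ∈ antisymm n) :
    skew n (upperEntries n X) = X := by
  ext i j
  rcases lt_trichotomy i j with h | rfl | h
  · simp [skew_apply, upperMat_apply, h, not_lt_of_gt h]
  · have := antisymm_apply hX i i
    simp only [skew_apply, sub_self]
    linarith
  · simp [skew_apply, upperMat_apply, h, not_lt_of_gt h, antisymm_apply hX i j]

theorem lowerMat_blockTriangular {n : ℕ} (l : LowPairs n → ℝ) :
    (lowerMat n l).BlockTriangular OrderDual.toDual := by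
  intro i j h
  have : i < j := h
  simp [lowerMat_apply, this]

theorem det_lowerMat_pos {n : ℕ} {l : LowPairs n → ℝ} (hl : ∀ q, 0 < l q) :
    0 < (lowerMat n l).det := by
  rw [Matrix.det_of_isLowerTriangular _ (lowerMat_blockTriangular l)]
  exact Finset.prod_pos fun i _ => by simpa [lowerMat_apply] using hl _

/-- The determinant of left multiplication by a matrix. -/
theorem det_mulLeft_matrix {n : ℕ} (A : Mat n) :
    LinearMap.det (LinearMap.mulLeft ℝ A) = A.det ^ n := by
  let e : Mat n ≃ₗ[ℝ] (Fin n → Fin n → ℝ) :=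
    { toFun M := fun i j => M j i
      map_add' _ _ := rfl
      map_smul' _ _ := rfl
      invFun N := Matrix.of fun i j => N j i
      left_inv _ := rfl
      right_inv _ := rfl }
  have h : ((e : Mat n →ₗ[ℝ] _) ∘ₗ LinearMap.mulLeft ℝ A ∘ₗ (e.symm : (Fin n → Fin n → ℝ) →ₗ[ℝ] Mat n)) =
      LinearMap.pi fun i => Matrix.toLin' A ∘ₗ LinearMap.proj i := by
    refine LinearMap.ext fun M => ?_
    funext i j
    exact (Matrix.mul_apply (M := A) (N := Matrix.of fun i j => M j i) (i := j) (k := i))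
  rw [← LinearMap.det_conj _ e, h, LinearMap.det_pi]
  simp

theorem transpose_mul_coe {n : ℕ} (A : SO n) : (A : Mat n).transpose * (A : Mat n) = 1 := by
  simpa [Matrix.star_eq_conjTranspose] using
    Matrix.mem_unitaryGroup_iff'.1 (Matrix.mem_specialUnitaryGroup_iff.1 A.2).1

theorem coe_mul_transpose {n : ℕ} (A : SO n) : (A : Mat n) * (A : Mat n).transpose = 1 :=
  mul_eq_one_comm.1 (transpose_mul_coe A)

theorem det_coe {n : ℕ} (A : SO n) : (A : Mat n).det = 1 :=
  (Matrix.mem_specialUnitaryGroup_iff.1 A.2).2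

theorem coe_inv {n : ℕ} (A : SO n) : ((A⁻¹ : SO n) : Mat n) = (A : Mat n).transpose := by
  have h : ((A⁻¹ : SO n) : Mat n) * (A : Mat n) = 1 := by
    rw [← Submonoid.coe_mul, inv_mul_cancel]; rfl
  calc ((A⁻¹ : SO n) : Mat n) = ((A⁻¹ : SO n) : Mat n) * ((A : Mat n) * (A : Mat n).transpose) := by
        rw [coe_mul_transpose, mul_one]
    _ = _ := by rw [← mul_assoc, h, one_mul]

theorem mem_SO_iff {n : ℕ} {M : Mat n} :
    M ∈ Matrix.specialOrthogonalGroup (Fin n) ℝ ↔ M.transpose * M = 1 ∧ M.det = 1 := by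
  refine ⟨fun h => ⟨transpose_mul_coe ⟨M, h⟩, det_coe ⟨M, h⟩⟩, fun h => ?_⟩
  refine Matrix.mem_specialUnitaryGroup_iff.2 ⟨Matrix.mem_unitaryGroup_iff'.2 ?_, h.2⟩
  simpa [Matrix.star_eq_conjTranspose] using h.1

theorem abs_entry_le_one {n : ℕ} (A : SO n) (i j : Fin n) : |(A : Mat n) i j| ≤ 1 := by
  have h := congrFun (congrFun (transpose_mul_coe A) j) j
  simp only [Matrix.mul_apply, Matrix.transpose_apply, Matrix.one_apply_eq] at h
  have h2 := Finset.single_le_sum (f := fun k => (A : Mat n) k j * (A : Mat n) k j)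
    (fun k _ => mul_self_nonneg _) (Finset.mem_univ i)
  rw [abs_le_one_iff_mul_self_le_one]
  linarith

instance instIsTopologicalGroupSO (n : ℕ) : IsTopologicalGroup (SO n) where
  continuous_inv := by
    refine continuous_induced_rng.2 ?_
    have : (Subtype.val ∘ fun A : SO n => A⁻¹) = fun A : SO n => (A : Mat n).transpose :=
      funext coe_inv
    rw [this]
    exact continuous_subtype_val.matrix_transpose

theorem isClosed_SO (n : ℕ) :
    IsClosed (Matrix.specialOrthogonalGroup (Fin n) ℝ : Set (Mat n)) := by
  have : (Matrix.specialOrthogonalGroup (Fin n) ℝ : Set (Mat n)) =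
      {M | M.transpose * M = 1} ∩ {M | M.det = 1} := by
    ext M
    exact mem_SO_iff
  rw [this]
  exact (isClosed_eq (by fun_prop) continuous_const).inter (isClosed_eq (by fun_prop) continuous_const)

instance instCompactSpaceSO (n : ℕ) : CompactSpace (SO n) := by
  refine isCompact_iff_compactSpace.1 ?_
  have hK : IsCompact (Set.univ.pi fun _ : Fin n => Set.univ.pi fun _ : Fin n =>
      Set.Icc (-1 : ℝ) 1) :=
    isCompact_univ_pi fun _ => isCompact_univ_pi fun _ => isCompact_Icc
  refine IsCompact.of_isClosed_subset (X := Mat n) hK (isClosed_SO n) fun M hM i _ j _ => ?_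
  exact abs_le.1 (abs_entry_le_one ⟨M, hM⟩ i j)

instance instSecondCountableMat (n : ℕ) : SecondCountableTopology (Mat n) :=
  inferInstanceAs (SecondCountableTopology (Fin n → Fin n → ℝ))

instance instPolishSpaceMat (n : ℕ) : PolishSpace (Mat n) :=
  inferInstanceAs (PolishSpace (Fin n → Fin n → ℝ))

instance instPolishSpaceSO (n : ℕ) : PolishSpace (SO n) := (isClosed_SO n).polishSpace

instance instSecondCountableSO (n : ℕ) : SecondCountableTopology (SO n) := inferInstance

/-- Uniqueness of the decomposition of a matrix as a rotation times a lower triangular matrix with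
positive entries. -/
theorem rotation_mul_lowerMat_injective {n : ℕ} {A A' : SO n} {l l' : LowPairs n → ℝ}
    (hl : ∀ q, 0 < l q) (hl' : ∀ q, 0 < l' q)
    (h : (A : Mat n) * lowerMat n l = (A' : Mat n) * lowerMat n l') : A = A' ∧ l = l' := by
  set Q : SO n := A'⁻¹ * A with hQ
  have hQL : (Q : Mat n) * lowerMat n l = lowerMat n l' := by
    rw [hQ, Submonoid.coe_mul, mul_assoc, h, ← mul_assoc, coe_inv, transpose_mul_coe, one_mul]
  have hu : IsUnit (lowerMat n l).det := (det_lowerMat_pos hl).ne'.isUnit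
  let _ : Invertible (lowerMat n l) := Matrix.invertibleOfIsUnitDet _ hu
  have hQ1 : (Q : Mat n) = lowerMat n l' * (lowerMat n l)⁻¹ := by
    rw [← hQL, mul_assoc, Matrix.mul_nonsing_inv _ hu, mul_one]
  have hlow : (Q : Mat n).BlockTriangular OrderDual.toDual := by
    rw [hQ1]
    exact (lowerMat_blockTriangular l').mul
      (Matrix.blockTriangular_inv_of_blockTriangular (lowerMat_blockTriangular l))
  let _ : Invertible (Q : Mat n) := ⟨_, transpose_mul_coe Q, coe_mul_transpose Q⟩
  have hlow' : (Q : Mat n).transpose.BlockTriangular OrderDual.toDual := by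
    have := Matrix.blockTriangular_inv_of_blockTriangular hlow
    rwa [Matrix.inv_eq_left_inv (transpose_mul_coe Q)] at this
  have hQone : Q = 1 := by
    refine Subtype.ext (Matrix.ext fun i j => ?_)
    rcases lt_trichotomy i j with hij | rfl | hij
    · rw [hlow (i := i) (j := j) hij]
      exact (Matrix.one_apply_ne hij.ne).symm
    · have h1 := congrFun (congrFun (transpose_mul_coe Q) i) i
      rw [Matrix.mul_apply, Finset.sum_eq_single i, Matrix.one_apply_eq] at h1
      · have h2 := congrFun (congrFun hQL i) i
        rw [Matrix.mul_apply, Finset.sum_eq_single i] at h2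
        · have h3 := hl ⟨(i, i), lt_irrefl i⟩
          have h4 := hl' ⟨(i, i), lt_irrefl i⟩
          simp only [lowerMat_apply, lt_irrefl, dite_false] at h2
          rw [Matrix.transpose_apply] at h1
          have h5 : 0 < (Q : Mat n) i i := by
            by_contra hneg
            nlinarith
          have : (Q : Mat n) i i = 1 := by nlinarith
          rw [this]
          exact (Matrix.one_apply_eq i).symm
        · intro k _ hk
          rcases lt_or_gt_of_ne hk with hk | hk
          · rw [lowerMat_apply, dif_pos hk, mul_zero]
          · rw [hlow (i := i) (j := k) hk, zero_mul]
        · simp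
      · intro k _ hk
        rcases lt_or_gt_of_ne hk with hk | hk
        · rw [hlow (i := k) (j := i) hk, mul_zero]
        · rw [hlow' (i := i) (j := k) hk, zero_mul]
      · simp
    · have := hlow' (i := j) (j := i) hij
      rw [Matrix.transpose_apply] at this
      rw [this]
      exact (Matrix.one_apply_ne hij.ne').symm
  refine ⟨(inv_mul_eq_one.1 hQone).symm, ?_⟩
  rw [hQone] at hQL
  have : lowerMat n l = lowerMat n l' := by simpa using hQL
  have h2 := congrArg (fun M => (split n M).2) this
  simpa [lowerMat] using h2

/-- The linear map `(w, h) ↦ X w + h`, with `w` antisymmetric, `h` lower triangular, and `X` the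
right multiplication by the lower triangular matrix given by `l`. -/
def sliceMap (n : ℕ) (l : LowPairs n → ℝ) : Entries n →ₗ[ℝ] Entries n :=
  (split n).toLinearMap ∘ₗ
    ((LinearMap.mulRight ℝ (lowerMat n l) ∘ₗ skew n).coprod (lowerMat n))

theorem sliceMap_apply {n : ℕ} (l : LowPairs n → ℝ) (x : Entries n) :
    sliceMap n l x = split n (skew n x.1 * lowerMat n l + lowerMat n x.2) := rfl

theorem det_sliceMap_ne_zero {n : ℕ} {l : LowPairs n → ℝ} (hl : ∀ q, 0 < l q) :
    LinearMap.det (sliceMap n l) ≠ 0 := by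
  have hker : LinearMap.ker (sliceMap n l) = ⊥ := by
    refine LinearMap.ker_eq_bot'.2 fun x hx => ?_
    rw [sliceMap_apply, LinearEquiv.map_eq_zero_iff] at hx
    have hu : IsUnit (lowerMat n l).det := (det_lowerMat_pos hl).ne'.isUnit
    let _ : Invertible (lowerMat n l) := Matrix.invertibleOfIsUnitDet _ hu
    have h1 : skew n x.1 = lowerMat n (-x.2) * (lowerMat n l)⁻¹ := by
      rw [map_neg, ← eq_neg_of_add_eq_zero_left hx, mul_assoc, Matrix.mul_nonsing_inv _ hu, mul_one]
    have h2 : (skew n x.1).BlockTriangular OrderDual.toDual := by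
      rw [h1]
      exact (lowerMat_blockTriangular _).mul
        (Matrix.blockTriangular_inv_of_blockTriangular (lowerMat_blockTriangular l))
    have h3 : x.1 = 0 := by
      rw [← upperEntries_skew x.1]
      funext p
      exact h2 (i := p.1.1) (j := p.1.2) p.2
    refine Prod.ext h3 ?_
    rw [h3, map_zero, zero_mul, zero_add] at hx
    have h4 := congrArg (fun M => (split n M).2) hx
    simpa [lowerMat] using h4
  exact (LinearEquiv.ofInjectiveEndo _ (LinearMap.ker_eq_bot.1 hker)).isUnit_det'.ne_zero

/-- The entries of lower triangular matrices lying strictly between `0` and `1`. -/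
def lowBox (n : ℕ) : Set (LowPairs n → ℝ) := Set.univ.pi fun _ => Set.Ioo 0 1

theorem isOpen_lowBox (n : ℕ) : IsOpen (lowBox n) :=
  isOpen_set_pi Set.finite_univ fun _ _ => isOpen_Ioo

theorem lowBox_pos {n : ℕ} {l : LowPairs n → ℝ} (hl : l ∈ lowBox n) (q : LowPairs n) : 0 < l q :=
  (hl q (Set.mem_univ q)).1

instance instPolishSpaceLowBox (n : ℕ) : PolishSpace (lowBox n) := (isOpen_lowBox n).polishSpace

theorem continuous_linearMap_mat {n : ℕ} {E : Type*} [NormedAddCommGroup E] [NormedSpace ℝ E]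
    [FiniteDimensional ℝ E] (f : E →ₗ[ℝ] Mat n) : Continuous f :=
  f.continuous_of_finiteDimensional

theorem continuous_split (n : ℕ) : Continuous (split n) :=
  Continuous.prodMk
    (continuous_pi fun p : Pairs n => continuous_id.matrix_elem p.1.1 p.1.2)
    (continuous_pi fun q : LowPairs n => continuous_id.matrix_elem q.1.1 q.1.2)

instance instIsAddHaarMeasureEntries (n : ℕ) : (volume : Measure (Entries n)).IsAddHaarMeasure :=
  Measure.prod.instIsAddHaarMeasure (volume : Measure (Pairs n → ℝ))
    (volume : Measure (LowPairs n → ℝ))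

/-- The product of a rotation and a lower triangular matrix, read as an element of the space of
matrix entries. -/
def rotationMulLower (n : ℕ) (A : SO n) (l : LowPairs n → ℝ) : Entries n :=
  split n ((A : Mat n) * lowerMat n l)

theorem continuous_rotationMulLower (n : ℕ) :
    Continuous fun x : SO n × (LowPairs n → ℝ) => rotationMulLower n x.1 x.2 :=
  (continuous_split n).comp
    ((continuous_subtype_val.comp continuous_fst).matrix_mul
      ((continuous_linearMap_mat (lowerMat n)).comp continuous_snd))

theorem rotationMulLower_injective {n : ℕ} {A A' : SO n} {l l' : LowPairs n → ℝ}
    (hl : l ∈ lowBox n) (hl' : l' ∈ lowBox n)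
    (h : rotationMulLower n A l = rotationMulLower n A' l') : A = A' ∧ l = l' :=
  rotation_mul_lowerMat_injective (lowBox_pos hl) (lowBox_pos hl') ((split n).injective h)

/-- The product map restricted to the box `lowBox n`. -/
def thicken (n : ℕ) (x : SO n × lowBox n) : Entries n := rotationMulLower n x.1 x.2

theorem measurableEmbedding_thicken (n : ℕ) : MeasurableEmbedding (thicken n) := by
  refine Continuous.measurableEmbedding ?_ ?_
  · exact (continuous_rotationMulLower n).comp
      (continuous_fst.prodMk (continuous_subtype_val.comp continuous_snd))
  · rintro ⟨A, l⟩ ⟨A', l'⟩ h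
    obtain ⟨h1, h2⟩ := rotationMulLower_injective l.2 l'.2 h
    exact Prod.ext h1 (Subtype.ext h2)

/-- The measure of a set `S` of rotations is the Lebesgue measure of the set of matrices `A * L`
with `A` in `S` and `L` a lower triangular matrix with entries between `0` and `1`. -/
def thickMeasure (n : ℕ) : Measure (SO n) :=
  ((volume : Measure (Entries n)).comap (thicken n)).map Prod.fst

theorem thickMeasure_apply {n : ℕ} {S : Set (SO n)} (hS : MeasurableSet S) :
    thickMeasure n S =
      volume ((fun x : SO n × (LowPairs n → ℝ) => rotationMulLower n x.1 x.2) ''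
        (S ×ˢ lowBox n)) := by
  rw [thickMeasure, Measure.map_apply measurable_fst hS,
    (measurableEmbedding_thicken n).comap_apply]
  congr 1
  ext y
  constructor
  · rintro ⟨⟨A, l⟩, hA, rfl⟩
    exact ⟨(A, l), ⟨hA, l.2⟩, rfl⟩
  · rintro ⟨⟨A, l⟩, ⟨hA, hl⟩, rfl⟩
    exact ⟨(A, ⟨l, hl⟩), hA, rfl⟩

instance instIsFiniteMeasureThick (n : ℕ) : IsFiniteMeasure (thickMeasure n) where
  measure_univ_lt_top := by
    rw [thickMeasure_apply MeasurableSet.univ]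
    have hK : IsCompact ((fun x : SO n × (LowPairs n → ℝ) => rotationMulLower n x.1 x.2) ''
        (Set.univ ×ˢ Set.univ.pi fun _ => Set.Icc 0 1)) :=
      (isCompact_univ.prod (isCompact_univ_pi fun _ => isCompact_Icc)).image
        (continuous_rotationMulLower n)
    refine (measure_mono (Set.image_mono (Set.prod_mono subset_rfl ?_))).trans_lt hK.measure_lt_top
    exact Set.pi_mono fun _ _ => Set.Ioo_subset_Icc_self

/-- Left multiplication by a matrix, on the space of matrix entries. -/
def mulLeftEntries {n : ℕ} (A : Mat n) : Entries n →ₗ[ℝ] Entries n :=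
  (split n).toLinearMap ∘ₗ LinearMap.mulLeft ℝ A ∘ₗ (split n).symm.toLinearMap

theorem det_mulLeftEntries {n : ℕ} (A : SO n) : LinearMap.det (mulLeftEntries (A : Mat n)) = 1 := by
  rw [mulLeftEntries, LinearMap.det_conj, det_mulLeft_matrix, det_coe, one_pow]

theorem mulLeftEntries_rotationMulLower {n : ℕ} (A B : SO n) (l : LowPairs n → ℝ) :
    mulLeftEntries (A : Mat n) (rotationMulLower n B l) = rotationMulLower n (A * B) l := by
  simp [mulLeftEntries, rotationMulLower, mul_assoc]

instance instIsMulLeftInvariantThick (n : ℕ) : (thickMeasure n).IsMulLeftInvariant where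
  map_mul_left_eq_self g := by
    ext S hS
    have hm : MeasurableSet ((fun A : SO n => g * A) ⁻¹' S) := measurable_const_mul g hS
    rw [Measure.map_apply (measurable_const_mul g) hS, thickMeasure_apply hm,
      thickMeasure_apply hS]
    have h : (fun x : SO n × (LowPairs n → ℝ) => rotationMulLower n x.1 x.2) '' (S ×ˢ lowBox n) =
        mulLeftEntries (g : Mat n) '' ((fun x : SO n × (LowPairs n → ℝ) =>
          rotationMulLower n x.1 x.2) '' (((fun A : SO n => g * A) ⁻¹' S) ×ˢ lowBox n)) := by
      ext y
      constructor
      · rintro ⟨⟨A, l⟩, ⟨hA, hl⟩, rfl⟩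
        refine ⟨_, ⟨(g⁻¹ * A, l), ⟨?_, hl⟩, rfl⟩, ?_⟩
        · simpa using hA
        · simp only [mulLeftEntries_rotationMulLower, mul_inv_cancel_left]
      · rintro ⟨_, ⟨⟨A, l⟩, ⟨hA, hl⟩, rfl⟩, rfl⟩
        exact ⟨(g * A, l), ⟨hA, hl⟩, (mulLeftEntries_rotationMulLower g A l).symm⟩
    rw [h, Measure.addHaar_image_linearMap, det_mulLeftEntries]
    simp

theorem mem_tangentSpace_iff {n : ℕ} {A : SO n} {X : Mat n} :
    X ∈ tangentSpace A ↔ (A : Mat n).transpose * X ∈ antisymm n := by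
  constructor
  · rintro ⟨P, hP, rfl⟩
    simpa [← mul_assoc, transpose_mul_coe] using hP
  · intro h
    exact ⟨_, h, by simp [← mul_assoc, coe_mul_transpose]⟩

/-- The differential at `u` of a parametrization, as a matrix-valued linear map. -/
def chartDeriv {n : ℕ} (f : (Pairs n → ℝ) → SO n) (u : Pairs n → ℝ) :
    (Pairs n → ℝ) →ₗ[ℝ] Mat n where
  toFun w := Matrix.of fun i j => fderiv ℝ (fun v => (f v : Mat n) i j) u w
  map_add' w w' := by ext i j; simp
  map_smul' c w := by ext i j; simp

theorem chartDeriv_apply {n : ℕ} (f : (Pairs n → ℝ) → SO n) (u w : Pairs n → ℝ) (i j : Fin n) :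
    chartDeriv f u w i j = fderiv ℝ (fun v => (f v : Mat n) i j) u w := rfl

theorem chartDeriv_single {n : ℕ} (f : (Pairs n → ℝ) → SO n) (u : Pairs n → ℝ) (p : Pairs n) :
    chartDeriv f u (Pi.single p 1) = partialDeriv f p u := rfl

theorem chartDeriv_eq_sum {n : ℕ} (f : (Pairs n → ℝ) → SO n) (u w : Pairs n → ℝ) :
    chartDeriv f u w = ∑ p, w p • partialDeriv f p u := by
  conv_lhs => rw [pi_eq_sum_univ' w]
  rw [map_sum]
  refine Finset.sum_congr rfl fun p _ => ?_
  rw [map_smul, ← chartDeriv_single]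

theorem IsLocalParametrization.chartDeriv_mem {n : ℕ}
    {e : OpenPartialHomeomorph (Pairs n → ℝ) (SO n)} (he : IsLocalParametrization e)
    {u : Pairs n → ℝ} (hu : u ∈ e.source) (w : Pairs n → ℝ) :
    chartDeriv e u w ∈ tangentSpace (e u) := by
  rw [chartDeriv_eq_sum]
  exact Submodule.sum_mem _ fun p _ => Submodule.smul_mem _ _ (he.partialDeriv_mem hu p)

/-- The differential at `u` of a parametrization, moved to the tangent space at the identity and
read in the standard coordinates. -/
def chartFrame {n : ℕ} (f : (Pairs n → ℝ) → SO n) (u : Pairs n → ℝ) :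
    (Pairs n → ℝ) →ₗ[ℝ] (Pairs n → ℝ) :=
  upperEntries n ∘ₗ LinearMap.mulLeft ℝ (f u : Mat n).transpose ∘ₗ chartDeriv f u

theorem IsLocalParametrization.chartDeriv_eq {n : ℕ}
    {e : OpenPartialHomeomorph (Pairs n → ℝ) (SO n)} (he : IsLocalParametrization e)
    {u : Pairs n → ℝ} (hu : u ∈ e.source) (w : Pairs n → ℝ) :
    chartDeriv e u w = (e u : Mat n) * skew n (chartFrame e u w) := by
  have h := skew_upperEntries (mem_tangentSpace_iff.1 (he.chartDeriv_mem hu w))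
  change skew n (chartFrame e u w) = _ at h
  rw [h, ← mul_assoc, coe_mul_transpose, one_mul]

theorem IsLocalParametrization.contDiffOn_det_chartFrame {n : ℕ}
    {e : OpenPartialHomeomorph (Pairs n → ℝ) (SO n)} (he : IsLocalParametrization e) :
    ContDiffOn ℝ (⊤ : ℕ∞) (fun u => LinearMap.det (chartFrame e u)) e.source := by
  have hent : ∀ q p : Pairs n, ContDiffOn ℝ (⊤ : ℕ∞)
      (fun u => LinearMap.toMatrix' (chartFrame e u) q p) e.source := by
    intro q p
    have h : (fun u => LinearMap.toMatrix' (chartFrame e u) q p) = fun u =>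
        ∑ k, (e u : Mat n) k q.1.1 *
          fderiv ℝ (fun v => (e v : Mat n) k q.1.2) u (Pi.single p 1) := by
      funext u
      simp [LinearMap.toMatrix'_apply, chartFrame, Matrix.mul_apply, chartDeriv_apply]
    rw [h]
    refine ContDiffOn.sum fun k _ => (he.smooth _ _).mul ?_
    exact ((he.smooth k q.1.2).fderiv_of_isOpen e.open_source (by simp)).clm_apply contDiffOn_const
  simp only [← LinearMap.det_toMatrix', Matrix.det_apply]
  refine ContDiffOn.sum fun σ _ => ?_
  exact (contDiffOn_prod fun i _ => hent _ _).const_smul _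

/-- The differential of the map `(u, l) ↦ e u * L`, where `L` is the lower triangular matrix given
by `l`. -/
def thickDeriv {n : ℕ} (f : (Pairs n → ℝ) → SO n) (x : Entries n) : Entries n →ₗ[ℝ] Mat n :=
  (LinearMap.mulRight ℝ (lowerMat n x.2) ∘ₗ chartDeriv f x.1).coprod
    (LinearMap.mulLeft ℝ (f x.1 : Mat n) ∘ₗ lowerMat n)

theorem IsLocalParametrization.hasFDerivAt_rotationMulLower {n : ℕ}
    {e : OpenPartialHomeomorph (Pairs n → ℝ) (SO n)} (he : IsLocalParametrization e)
    {x : Entries n} (hx : x.1 ∈ e.source) :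
    HasFDerivAt (fun y : Entries n => rotationMulLower n (e y.1) y.2)
      (LinearMap.toContinuousLinearMap ((split n).toLinearMap ∘ₗ thickDeriv e x)) x := by
  have hent : ∀ i j : Fin n, HasFDerivAt
      (fun y : Entries n => ((e y.1 : Mat n) * lowerMat n y.2) i j)
      (LinearMap.toContinuousLinearMap (Matrix.entryLinearMap ℝ ℝ i j ∘ₗ thickDeriv e x)) x := by
    intro i j
    have h1 : ∀ k, HasFDerivAt (fun y : Entries n => (e y.1 : Mat n) i k)
        ((fderiv ℝ (fun v => (e v : Mat n) i k) x.1).comp (ContinuousLinearMap.fst ℝ _ _)) x :=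
      fun k => HasFDerivAt.comp (g := fun v => (e v : Mat n) i k) x
        (((he.smooth i k).contDiffAt (e.open_source.mem_nhds hx)).differentiableAt
          (by simp)).hasFDerivAt hasFDerivAt_fst
    have h2 : ∀ k, HasFDerivAt (fun y : Entries n => lowerMat n y.2 k j)
        (LinearMap.toContinuousLinearMap
          (Matrix.entryLinearMap ℝ ℝ k j ∘ₗ lowerMat n ∘ₗ LinearMap.snd ℝ _ _)) x :=
      fun k => ContinuousLinearMap.hasFDerivAt (LinearMap.toContinuousLinearMap
          (Matrix.entryLinearMap ℝ ℝ k j ∘ₗ lowerMat n ∘ₗ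
            LinearMap.snd ℝ (Pairs n → ℝ) (LowPairs n → ℝ)))
    have h3 := HasFDerivAt.fun_sum (u := Finset.univ) fun k _ => (h1 k).mul (h2 k)
    have h4 : (fun y : Entries n => ((e y.1 : Mat n) * lowerMat n y.2) i j) =
        fun y => ∑ k, (e y.1 : Mat n) i k * lowerMat n y.2 k j := by
      funext y
      exact Matrix.mul_apply
    rw [h4]
    refine h3.congr_fderiv (ContinuousLinearMap.ext fun y => ?_)
    simp only [thickDeriv, LinearMap.coe_toContinuousLinearMap', LinearMap.comp_apply,
      LinearMap.coprod_apply, LinearMap.mulRight_apply, LinearMap.mulLeft_apply,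
      Matrix.entryLinearMap_apply, Matrix.add_apply, Matrix.mul_apply, chartDeriv_apply,
      sum_apply, add_apply, smul_apply, smul_eq_mul, ContinuousLinearMap.comp_apply,
      ContinuousLinearMap.coe_fst', LinearMap.snd_apply, ← Finset.sum_add_distrib]
    refine Finset.sum_congr rfl fun k _ => ?_
    ring
  have h := (hasFDerivAt_pi.2 fun p : Pairs n => hent p.1.1 p.1.2).prodMk
    (hasFDerivAt_pi.2 fun q : LowPairs n => hent q.1.1 q.1.2)
  exact h.congr_fderiv (ContinuousLinearMap.ext fun y => rfl)

theorem IsLocalParametrization.det_split_thickDeriv {n : ℕ}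
    {e : OpenPartialHomeomorph (Pairs n → ℝ) (SO n)} (he : IsLocalParametrization e)
    {x : Entries n} (hx : x.1 ∈ e.source) :
    LinearMap.det ((split n).toLinearMap ∘ₗ thickDeriv e x) =
      LinearMap.det (chartFrame e x.1) * LinearMap.det (sliceMap n x.2) := by
  have h : (split n).toLinearMap ∘ₗ thickDeriv e x =
      mulLeftEntries (e x.1 : Mat n) ∘ₗ sliceMap n x.2 ∘ₗ
        (chartFrame e x.1).prodMap LinearMap.id := by
    refine LinearMap.ext fun y => ?_
    simp [thickDeriv, mulLeftEntries, sliceMap_apply, he.chartDeriv_eq hx, mul_add, mul_assoc]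
  rw [h, LinearMap.det_comp, LinearMap.det_comp, det_mulLeftEntries, LinearMap.det_prodMap,
    LinearMap.det_id]
  ring

theorem continuous_det_sliceMap (n : ℕ) :
    Continuous fun l => LinearMap.det (sliceMap n l) := by
  have h : Continuous fun l => LinearMap.toContinuousLinearMap (sliceMap n l) := by
    refine continuous_clm_apply.2 fun x => ?_
    exact (continuous_split n).comp ((continuous_const.matrix_mul
      (continuous_linearMap_mat (lowerMat n))).add continuous_const)
  exact ContinuousLinearMap.continuous_det.comp h

/-- The factor relating `thickMeasure` to the coordinate expression of the invariant volume. -/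
def boxFactor (n : ℕ) : ENNReal :=
  ∫⁻ l in lowBox n, ENNReal.ofReal |LinearMap.det (sliceMap n l)|

theorem boxFactor_ne_zero (n : ℕ) : boxFactor n ≠ 0 := by
  refine (setLIntegral_pos_iff ?_).2 ?_ |>.ne'
  · exact (continuous_det_sliceMap n).abs.measurable.ennreal_ofReal
  · have hsub : lowBox n ⊆ (Function.support fun l =>
        ENNReal.ofReal |LinearMap.det (sliceMap n l)|) ∩ lowBox n := fun l hl => by
      refine ⟨?_, hl⟩
      simpa using det_sliceMap_ne_zero (lowBox_pos hl)
    refine lt_of_lt_of_le ?_ (measure_mono hsub)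
    refine (isOpen_lowBox n).measure_pos volume ⟨fun _ => 1 / 2, fun _ _ => ?_⟩
    norm_num

theorem boxFactor_ne_top (n : ℕ) : boxFactor n ≠ ⊤ := by
  have hK : IsCompact (Set.univ.pi fun _ : LowPairs n => Set.Icc (0 : ℝ) 1) :=
    isCompact_univ_pi fun _ => isCompact_Icc
  have hi := ((continuous_det_sliceMap n).abs.continuousOn.integrableOn_compact
    (μ := volume) hK).mono_set (Set.pi_mono fun _ _ => Set.Ioo_subset_Icc_self :
      lowBox n ⊆ _)
  have := hi.hasFiniteIntegral
  rw [hasFiniteIntegral_iff_ofReal (Filter.Eventually.of_forall fun _ => abs_nonneg _)] at this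
  exact this.ne

/-- The expression of `thickMeasure` in local coordinates. -/
theorem IsLocalParametrization.thickMeasure_image {n : ℕ}
    {e : OpenPartialHomeomorph (Pairs n → ℝ) (SO n)} (he : IsLocalParametrization e)
    {S : Set (Pairs n → ℝ)} (hS : MeasurableSet S) (hSe : S ⊆ e.source) :
    thickMeasure n (e '' S) =
      (∫⁻ u in S, ENNReal.ofReal |LinearMap.det (chartFrame e u)|) * boxFactor n := by
  have hmeas : MeasurableSet (e '' S) :=
    hS.image_of_continuousOn_injOn (e.continuousOn.mono hSe) (e.injOn.mono hSe)
  have himage : (fun x : SO n × (LowPairs n → ℝ) => rotationMulLower n x.1 x.2) ''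
      ((e '' S) ×ˢ lowBox n) =
      (fun y : Entries n => rotationMulLower n (e y.1) y.2) '' (S ×ˢ lowBox n) := by
    ext z
    constructor
    · rintro ⟨⟨_, l⟩, ⟨⟨u, hu, rfl⟩, hl⟩, rfl⟩
      exact ⟨(u, l), ⟨hu, hl⟩, rfl⟩
    · rintro ⟨⟨u, l⟩, ⟨hu, hl⟩, rfl⟩
      exact ⟨(e u, l), ⟨⟨u, hu, rfl⟩, hl⟩, rfl⟩
  have hbox : MeasurableSet (lowBox n) := (isOpen_lowBox n).measurableSet
  have hinj : Set.InjOn (fun y : Entries n => rotationMulLower n (e y.1) y.2)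
      (S ×ˢ lowBox n) := by
    rintro ⟨u, l⟩ ⟨hu, hl⟩ ⟨u', l'⟩ ⟨hu', hl'⟩ h
    obtain ⟨h1, h2⟩ := rotationMulLower_injective hl hl' h
    exact Prod.ext (e.injOn (hSe hu) (hSe hu') h1) h2
  rw [thickMeasure_apply hmeas, himage, ← lintegral_abs_det_fderiv_eq_addHaar_image volume
    (hS.prod hbox) (fun x hx => (he.hasFDerivAt_rotationMulLower (hSe hx.1)).hasFDerivWithinAt)
    hinj]
  have hcongr : ∫⁻ x in S ×ˢ lowBox n, ENNReal.ofReal |(LinearMap.toContinuousLinearMap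
      ((split n).toLinearMap ∘ₗ thickDeriv e x)).det| =
      ∫⁻ x in S ×ˢ lowBox n, ENNReal.ofReal |LinearMap.det (chartFrame e x.1)| *
        ENNReal.ofReal |LinearMap.det (sliceMap n x.2)| := by
    refine setLIntegral_congr_fun (hS.prod hbox) fun x hx => ?_
    rw [← ENNReal.ofReal_mul (abs_nonneg _), ← abs_mul,
      ← he.det_split_thickDeriv (hSe hx.1)]
    rfl
  rw [hcongr, Measure.volume_eq_prod, ← Measure.prod_restrict]
  have h1 : AEMeasurable (fun u => ENNReal.ofReal |LinearMap.det (chartFrame e u)|)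
      (volume.restrict S) :=
    ((he.contDiffOn_det_chartFrame.continuousOn.mono hSe).abs.aemeasurable hS).ennreal_ofReal
  have h2 : AEMeasurable (fun l => ENNReal.ofReal |LinearMap.det (sliceMap n l)|)
      (volume.restrict (lowBox n)) :=
    (continuous_det_sliceMap n).abs.measurable.ennreal_ofReal.aemeasurable
  exact lintegral_prod_mul h1 h2

theorem det_one_sub_skew_ne_zero {n : ℕ} (u : Pairs n → ℝ) : (1 - skew n u).det ≠ 0 := by
  intro h
  obtain ⟨v, hv, hv0⟩ := Matrix.exists_mulVec_eq_zero_iff.2 h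
  refine hv ?_
  rw [Matrix.sub_mulVec, Matrix.one_mulVec, sub_eq_zero] at hv0
  have h1 : v ⬝ᵥ (skew n u).mulVec v = -(v ⬝ᵥ (skew n u).mulVec v) := by
    conv_lhs => rw [Matrix.dotProduct_mulVec, ← Matrix.mulVec_transpose, transpose_skew,
      Matrix.neg_mulVec, neg_dotProduct, dotProduct_comm]
  rw [← hv0] at h1
  exact dotProduct_self_eq_zero.1 (by linarith)

theorem transpose_one_sub_skew {n : ℕ} (u : Pairs n → ℝ) :
    (1 - skew n u).transpose = 1 + skew n u := by
  rw [Matrix.transpose_sub, Matrix.transpose_one, transpose_skew, sub_neg_eq_add]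

theorem transpose_one_add_skew {n : ℕ} (u : Pairs n → ℝ) :
    (1 + skew n u).transpose = 1 - skew n u := by
  rw [← transpose_one_sub_skew, Matrix.transpose_transpose]

/-- The Cayley transform `(1 + X) (1 - X)⁻¹` of an antisymmetric matrix `X`. -/
def cayleyMat (n : ℕ) (u : Pairs n → ℝ) : Mat n := (1 + skew n u) * (1 - skew n u)⁻¹

theorem cayleyMat_mul {n : ℕ} (u : Pairs n → ℝ) :
    cayleyMat n u * (1 - skew n u) = 1 + skew n u := by
  rw [cayleyMat, mul_assoc, Matrix.nonsing_inv_mul _ (det_one_sub_skew_ne_zero u).isUnit, mul_one]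

theorem cayleyMat_add_one_mul {n : ℕ} (u : Pairs n → ℝ) :
    (cayleyMat n u + 1) * (1 - skew n u) = (2 : ℝ) • 1 := by
  rw [add_mul, cayleyMat_mul, one_mul, two_smul]
  abel

theorem cayleyMat_sub_one_mul {n : ℕ} (u : Pairs n → ℝ) :
    (cayleyMat n u - 1) * (1 - skew n u) = (2 : ℝ) • skew n u := by
  rw [sub_mul, cayleyMat_mul, one_mul, two_smul]
  abel

theorem det_cayleyMat_add_one_ne_zero {n : ℕ} (u : Pairs n → ℝ) :
    (cayleyMat n u + 1).det ≠ 0 := by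
  intro h
  have := congrArg Matrix.det (cayleyMat_add_one_mul u)
  rw [Matrix.det_mul, h, zero_mul, Matrix.det_smul, Matrix.det_one] at this
  simp only [mul_one, Fintype.card_fin] at this
  exact pow_ne_zero n (two_ne_zero' ℝ) this.symm

theorem cayleyMat_mem {n : ℕ} (u : Pairs n → ℝ) :
    cayleyMat n u ∈ Matrix.specialOrthogonalGroup (Fin n) ℝ := by
  have hu := (det_one_sub_skew_ne_zero u).isUnit
  have hu' : IsUnit (1 + skew n u).det := by
    rw [← transpose_one_sub_skew, Matrix.det_transpose]
    exact hu
  refine mem_SO_iff.2 ⟨?_, ?_⟩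
  · have hcomm : (1 - skew n u) * (1 + skew n u) = (1 + skew n u) * (1 - skew n u) := by
      noncomm_ring
    rw [cayleyMat, Matrix.transpose_mul, Matrix.transpose_nonsing_inv, transpose_one_sub_skew,
      transpose_one_add_skew, mul_assoc, ← mul_assoc (1 - skew n u), hcomm, mul_assoc,
      Matrix.mul_nonsing_inv _ hu, mul_one, Matrix.nonsing_inv_mul _ hu']
  · have h := congrArg Matrix.det (cayleyMat_mul u)
    rw [Matrix.det_mul, ← transpose_one_sub_skew, Matrix.det_transpose] at h
    exact mul_right_cancel₀ (det_one_sub_skew_ne_zero u) (h.trans (one_mul _).symm)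

/-- The inverse `(B - 1) (B + 1)⁻¹` of the Cayley transform. -/
def cayleyInv (n : ℕ) (B : Mat n) : Mat n := (B - 1) * (B + 1)⁻¹

theorem cayleyInv_cayleyMat {n : ℕ} (u : Pairs n → ℝ) :
    cayleyInv n (cayleyMat n u) = skew n u := by
  have hinv : (cayleyMat n u + 1)⁻¹ = (2⁻¹ : ℝ) • (1 - skew n u) := by
    refine Matrix.inv_eq_right_inv ?_
    rw [Matrix.mul_smul, cayleyMat_add_one_mul, smul_smul]
    norm_num
  rw [cayleyInv, hinv, Matrix.mul_smul, cayleyMat_sub_one_mul, smul_smul]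
  norm_num

theorem cayleyInv_mem {n : ℕ} {B : SO n} (hB : ((B : Mat n) + 1).det ≠ 0) :
    cayleyInv n (B : Mat n) ∈ antisymm n := by
  set b : Mat n := (B : Mat n) with hb
  have hu := hB.isUnit
  have hu' : IsUnit (b.transpose + 1).det := by
    have : b.transpose + 1 = (b + 1).transpose := by
      rw [Matrix.transpose_add, Matrix.transpose_one]
    rw [this, Matrix.det_transpose]
    exact hu
  have key : (b.transpose - 1) * (b + 1) = -((b.transpose + 1) * (b - 1)) := by
    have h := transpose_mul_coe B
    rw [← hb] at h
    simp only [sub_mul, add_mul, mul_add, mul_sub, h, one_mul, mul_one]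
    abel
  change (cayleyInv n b).transpose = -cayleyInv n b
  rw [cayleyInv, Matrix.transpose_mul, Matrix.transpose_nonsing_inv, Matrix.transpose_sub,
    Matrix.transpose_add, Matrix.transpose_one]
  calc (b.transpose + 1)⁻¹ * (b.transpose - 1)
      = (b.transpose + 1)⁻¹ * ((b.transpose - 1) * (b + 1)) * (b + 1)⁻¹ := by
        rw [mul_assoc, mul_assoc, Matrix.mul_nonsing_inv _ hu, mul_one]
    _ = -((b.transpose + 1)⁻¹ * (b.transpose + 1) * ((b - 1) * (b + 1)⁻¹)) := by
        rw [key]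
        simp only [mul_neg, neg_mul, mul_assoc]
    _ = _ := by rw [Matrix.nonsing_inv_mul _ hu', one_mul]

theorem cayleyMat_cayleyInv {n : ℕ} {B : SO n} (hB : ((B : Mat n) + 1).det ≠ 0) :
    cayleyMat n (upperEntries n (cayleyInv n (B : Mat n))) = B := by
  have hu := hB.isUnit
  set X := cayleyInv n (B : Mat n) with hX
  have h1 : skew n (upperEntries n X) = X := skew_upperEntries (cayleyInv_mem hB)
  have h2 : X * ((B : Mat n) + 1) = (B : Mat n) - 1 := by
    rw [hX, cayleyInv, mul_assoc, Matrix.nonsing_inv_mul _ hu, mul_one]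
  have h3 : (1 + X) * ((B : Mat n) + 1) = (2 : ℝ) • (B : Mat n) := by
    rw [add_mul, h2, one_mul, two_smul]
    abel
  have h4 : (1 - X) * ((B : Mat n) + 1) = (2 : ℝ) • 1 := by
    rw [sub_mul, h2, one_mul, two_smul]
    abel
  have hinv : (1 - X)⁻¹ = (2⁻¹ : ℝ) • ((B : Mat n) + 1) := by
    refine Matrix.inv_eq_right_inv ?_
    rw [Matrix.mul_smul, h4, smul_smul]
    norm_num
  rw [cayleyMat, h1, hinv, Matrix.mul_smul, h3, smul_smul]
  norm_num

theorem continuous_cayleyMat (n : ℕ) : Continuous (cayleyMat n) := by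
  have hs : Continuous (skew n) := continuous_linearMap_mat _
  have h : cayleyMat n = fun u => (1 + skew n u) *
      ((1 - skew n u).det⁻¹ • (1 - skew n u).adjugate) := by
    funext u
    rw [cayleyMat, Matrix.inv_def, Ring.inverse_eq_inv']
  rw [h]
  have hsub : Continuous fun u => 1 - skew n u := continuous_const.sub hs
  exact (continuous_const.add hs).matrix_mul
    ((hsub.matrix_det.inv₀ det_one_sub_skew_ne_zero).smul hsub.matrix_adjugate)

/-- The parametrization of a neighbourhood of `A` by the Cayley transform. -/
def cayleyChart {n : ℕ} (A : SO n) : OpenPartialHomeomorph (Pairs n → ℝ) (SO n) where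
  toFun u := A * ⟨cayleyMat n u, cayleyMat_mem u⟩
  invFun B := upperEntries n (cayleyInv n ((A⁻¹ * B : SO n) : Mat n))
  source := Set.univ
  target := {B | (((A⁻¹ * B : SO n) : Mat n) + 1).det ≠ 0}
  map_source' u _ := by
    change (((A⁻¹ * (A * ⟨cayleyMat n u, cayleyMat_mem u⟩) : SO n) : Mat n) + 1).det ≠ 0
    rw [inv_mul_cancel_left]
    exact det_cayleyMat_add_one_ne_zero u
  map_target' _ _ := Set.mem_univ _
  left_inv' u _ := by
    rw [inv_mul_cancel_left, cayleyInv_cayleyMat, upperEntries_skew]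
  right_inv' _ hB := eq_inv_mul_iff_mul_eq.1 (Subtype.ext (cayleyMat_cayleyInv hB))
  open_source := isOpen_univ
  open_target := by
    refine isOpen_ne_fun ?_ continuous_const
    exact ((continuous_subtype_val.comp (continuous_const.mul continuous_id)).add
      continuous_const).matrix_det
  continuousOn_toFun :=
    (continuous_const.mul ((continuous_cayleyMat n).subtype_mk _)).continuousOn
  continuousOn_invFun := by
    have hc : Continuous fun B : SO n => ((A⁻¹ * B : SO n) : Mat n) :=
      continuous_subtype_val.comp (continuous_const.mul continuous_id)
    have h : (fun B : SO n => upperEntries n (cayleyInv n ((A⁻¹ * B : SO n) : Mat n))) =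
        fun B : SO n => upperEntries n ((((A⁻¹ * B : SO n) : Mat n) - 1) *
          ((((A⁻¹ * B : SO n) : Mat n) + 1).det⁻¹ •
            (((A⁻¹ * B : SO n) : Mat n) + 1).adjugate)) := by
      funext B
      rw [cayleyInv, Matrix.inv_def, Ring.inverse_eq_inv']
    rw [h]
    have hup : Continuous (upperEntries n) := continuous_fst.comp (continuous_split n)
    have hadd : Continuous fun B : SO n => ((A⁻¹ * B : SO n) : Mat n) + 1 :=
      hc.add continuous_const
    have hdet : ContinuousOn (fun B : SO n => (((A⁻¹ * B : SO n) : Mat n) + 1).det⁻¹)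
        {B | (((A⁻¹ * B : SO n) : Mat n) + 1).det ≠ 0} :=
      hadd.matrix_det.continuousOn.inv₀ fun B hB => hB
    exact hup.comp_continuousOn ((hc.sub continuous_const).continuousOn.mul
      (hdet.smul hadd.matrix_adjugate.continuousOn))

theorem mem_cayleyChart_target {n : ℕ} (A : SO n) : A ∈ (cayleyChart A).target := by
  change (((A⁻¹ * A : SO n) : Mat n) + 1).det ≠ 0
  rw [inv_mul_cancel]
  have : ((1 : SO n) : Mat n) + 1 = (2 : ℝ) • 1 := by
    rw [two_smul]
    rfl
  rw [this, Matrix.det_smul, Matrix.det_one]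
  simp

theorem contDiff_det {n : ℕ} {E : Type*} [NormedAddCommGroup E] [NormedSpace ℝ E]
    {M : E → Mat n} (hM : ∀ i j, ContDiff ℝ (⊤ : ℕ∞) fun x => M x i j) :
    ContDiff ℝ (⊤ : ℕ∞) fun x => (M x).det := by
  simp only [Matrix.det_apply]
  exact ContDiff.sum fun σ _ => (contDiff_prod fun i _ => hM _ _).const_smul _

theorem contDiff_cayleyMat (n : ℕ) (i j : Fin n) :
    ContDiff ℝ (⊤ : ℕ∞) fun u => cayleyMat n u i j := by
  have hs : ∀ i j, ContDiff ℝ (⊤ : ℕ∞) fun u => skew n u i j := fun i j =>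
    ContinuousLinearMap.contDiff
      (LinearMap.toContinuousLinearMap (Matrix.entryLinearMap ℝ ℝ i j ∘ₗ skew n))
  have hsub : ∀ i j, ContDiff ℝ (⊤ : ℕ∞) fun u => (1 - skew n u) i j := fun i j =>
    contDiff_const.sub (hs i j)
  have h : (fun u => cayleyMat n u i j) = fun u => ∑ k, (1 + skew n u) i k *
      ((1 - skew n u).det⁻¹ * (1 - skew n u).adjugate k j) := by
    funext u
    rw [cayleyMat, Matrix.inv_def, Ring.inverse_eq_inv', Matrix.mul_apply]
    rfl
  rw [h]
  refine ContDiff.sum fun k _ => (contDiff_const.add (hs i k)).mul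
    (((contDiff_det hsub).inv det_one_sub_skew_ne_zero).mul ?_)
  simp only [Matrix.adjugate_apply]
  refine contDiff_det fun a b => ?_
  by_cases hab : a = j
  · subst hab
    simpa using contDiff_const
  · simpa [Matrix.updateRow_ne hab] using hsub a b

theorem isLocalParametrization_cayleyChart {n : ℕ} (A : SO n) :
    IsLocalParametrization (cayleyChart A) := by
  have hval : ∀ u, ((cayleyChart A u : SO n) : Mat n) = (A : Mat n) * cayleyMat n u :=
    fun _ => rfl
  have hsm : ∀ i j, ContDiff ℝ (⊤ : ℕ∞)
      (fun u => ((cayleyChart A u : SO n) : Mat n) i j) := fun i j => by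
    simp only [hval, Matrix.mul_apply]
    exact ContDiff.sum fun k _ => contDiff_const.mul (contDiff_cayleyMat n k j)
  refine ⟨fun i j => (hsm i j).contDiffOn, fun u _ => ?_⟩
  refine Fintype.linearIndependent_iff.2 fun c hc => ?_
  rw [← chartDeriv_eq_sum] at hc
  have hent : ∀ i j : Fin n, ∑ k, (((cayleyChart A u : SO n) : Mat n) i k * -(skew n c k j)) =
      ∑ k, (A : Mat n) i k * skew n c k j := by
    intro i j
    have hf : ∀ k, HasFDerivAt (fun v => ((cayleyChart A v : SO n) : Mat n) i k)
        (fderiv ℝ (fun v => ((cayleyChart A v : SO n) : Mat n) i k) u) u := fun k =>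
      ((hsm i k).differentiable (by simp) u).hasFDerivAt
    have hs : ∀ k, HasFDerivAt (fun v => skew n v k j)
        (LinearMap.toContinuousLinearMap (Matrix.entryLinearMap ℝ ℝ k j ∘ₗ skew n)) u := fun k =>
      ContinuousLinearMap.hasFDerivAt
        (LinearMap.toContinuousLinearMap (Matrix.entryLinearMap ℝ ℝ k j ∘ₗ skew n))
    have hl := HasFDerivAt.fun_sum (u := Finset.univ) fun k _ =>
      (hf k).mul ((hs k).const_sub ((1 : Mat n) k j))
    have hr := HasFDerivAt.fun_sum (u := Finset.univ) fun k _ =>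
      ((hs k).const_add ((1 : Mat n) k j)).const_mul ((A : Mat n) i k)
    have heq : (fun v => ∑ k, ((cayleyChart A v : SO n) : Mat n) i k *
        ((1 : Mat n) k j - skew n v k j)) =
        fun v => ∑ k, (A : Mat n) i k * ((1 : Mat n) k j + skew n v k j) := by
      funext v
      have h1 : ((cayleyChart A v : SO n) : Mat n) * (1 - skew n v) =
          (A : Mat n) * (1 + skew n v) := by
        rw [hval, mul_assoc, cayleyMat_mul]
      have h2 := congrFun (congrFun h1 i) j
      rw [Matrix.mul_apply, Matrix.mul_apply] at h2
      exact h2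
    have h2 := congrArg (fun L => L c) (hl.unique (heq ▸ hr))
    have h0 : ∀ k, fderiv ℝ (fun v => ((cayleyChart A v : SO n) : Mat n) i k) u c = 0 :=
      fun k => congrFun (congrFun hc i) k
    simpa [h0] using h2
  have hmat : ((cayleyChart A u : SO n) : Mat n) * -(skew n c) = (A : Mat n) * skew n c := by
    ext i j
    rw [Matrix.mul_apply, Matrix.mul_apply]
    exact hent i j
  have h1 : (A : Mat n) * ((cayleyMat n u + 1) * skew n c) = 0 := by
    rw [add_mul, mul_add, one_mul, ← hmat, hval]
    simp [mul_assoc]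
  have h2 : (cayleyMat n u + 1) * skew n c = 0 := by
    have := congrArg (fun M => (A : Mat n).transpose * M) h1
    simpa [← mul_assoc, transpose_mul_coe] using this
  have h3 : skew n c = 0 := by
    have := congrArg (fun M => (cayleyMat n u + 1)⁻¹ * M) h2
    simpa [← mul_assoc, Matrix.nonsing_inv_mul _ (det_cayleyMat_add_one_ne_zero u).isUnit]
      using this
  have h4 := upperEntries_skew c
  rw [h3, map_zero] at h4
  intro p
  rw [← h4]
  rfl

/-- The coordinates of a tangent vector `X` at `A`: the entries of `Aᵀ X` above the diagonal. -/
def tangentCoord {n : ℕ} (A : SO n) : tangentSpace A ≃ₗ[ℝ] (Pairs n → ℝ) where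
  toFun X := upperEntries n ((A : Mat n).transpose * (X : Mat n))
  map_add' X Y := by simp [mul_add]
  map_smul' c X := by simp
  invFun w := ⟨(A : Mat n) * skew n w, skew n w, skew_mem w, rfl⟩
  left_inv X := by
    refine Subtype.ext ?_
    change (A : Mat n) * skew n (upperEntries n ((A : Mat n).transpose * (X : Mat n))) = X
    rw [skew_upperEntries (mem_tangentSpace_iff.1 X.2), ← mul_assoc, coe_mul_transpose, one_mul]
  right_inv w := by
    change upperEntries n ((A : Mat n).transpose * ((A : Mat n) * skew n w)) = w
    rw [← mul_assoc, transpose_mul_coe, one_mul, upperEntries_skew]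

theorem tangentCoord_apply {n : ℕ} (A : SO n) (X : tangentSpace A) (p : Pairs n) :
    tangentCoord A X p = ((A : Mat n).transpose * (X : Mat n)) p.1.1 p.1.2 := rfl

/-- The standard basis of the tangent space at `A`. -/
def tangentBasis {n : ℕ} (A : SO n) : Module.Basis (Pairs n) ℝ (tangentSpace A) :=
  Module.Basis.ofEquivFun (tangentCoord A)

/-- The left invariant form which is equal to `1` on the standard bases of the tangent spaces. -/
def standardForm (n : ℕ) : TopForm n := fun A => (tangentBasis A).det

theorem sum_antisymm_mul {n : ℕ} {P Q : Mat n} (hP : P ∈ antisymm n) (hQ : Q ∈ antisymm n) :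
    ∑ x : Fin n × Fin n, P x.1 x.2 * Q x.1 x.2 =
      2 * ∑ p : Pairs n, P p.1.1 p.1.2 * Q p.1.1 p.1.2 := by
  set f : Fin n × Fin n → ℝ := fun x => P x.1 x.2 * Q x.1 x.2 with hf
  have hsym : ∀ x, f x.swap = f x := fun x => by
    simp only [hf, Prod.fst_swap, Prod.snd_swap]
    rw [antisymm_apply hP x.2, antisymm_apply hQ x.2, neg_mul_neg]
  have hdiag : ∀ x : Fin n × Fin n, x.1 = x.2 → f x = 0 := fun x hx => by
    have := antisymm_apply hP x.1 x.1
    have h0 : P x.1 x.2 = 0 := by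
      rw [← hx]
      linarith
    simp [hf, h0]
  have hsplit : ∀ x : Fin n × Fin n, f x =
      (if x.1 < x.2 then f x else 0) + (if x.swap.1 < x.swap.2 then f x.swap else 0) := fun x => by
    rw [hsym]
    rcases lt_trichotomy x.1 x.2 with h | h | h
    · simp [h, not_lt_of_gt h]
    · simp [h, hdiag x h]
    · simp [h, not_lt_of_gt h]
  have hswap : ∑ x : Fin n × Fin n, (if x.swap.1 < x.swap.2 then f x.swap else 0) =
      ∑ x : Fin n × Fin n, (if x.1 < x.2 then f x else 0) :=
    (Equiv.prodComm (Fin n) (Fin n)).sum_comp fun x => if x.1 < x.2 then f x else 0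
  have hsub : ∑ x : Fin n × Fin n, (if x.1 < x.2 then f x else 0) = ∑ p : Pairs n, f p.1 := by
    rw [← Finset.sum_filter]
    exact Finset.sum_subtype _ (by simp) f
  rw [Finset.sum_congr rfl fun x _ => hsplit x, Finset.sum_add_distrib, hswap, hsub]
  ring

theorem matInner_tangent {n : ℕ} (A : SO n) (X Y : tangentSpace A) :
    matInner (X : Mat n) (Y : Mat n) = ∑ p, tangentCoord A X p * tangentCoord A Y p := by
  have h : (X : Mat n).transpose * (Y : Mat n) =
      ((A : Mat n).transpose * (X : Mat n)).transpose * ((A : Mat n).transpose * (Y : Mat n)) := by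
    rw [Matrix.transpose_mul, Matrix.transpose_transpose, mul_assoc, ← mul_assoc (A : Mat n),
      coe_mul_transpose, one_mul]
  have hsum := sum_antisymm_mul (mem_tangentSpace_iff.1 X.2) (mem_tangentSpace_iff.1 Y.2)
  simp only [tangentCoord_apply]
  rw [matInner, h, Matrix.trace]
  simp only [Matrix.diag_apply]
  simp only [Matrix.mul_apply (M := ((A : Mat n).transpose * (X : Mat n)).transpose),
    Matrix.transpose_apply ((A : Mat n).transpose * (X : Mat n))]
  rw [Finset.sum_comm, ← Fintype.sum_prod_type', hsum]
  ring

theorem tangentBasis_orthonormal {n : ℕ} (A : SO n) (p q : Pairs n) :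
    matInner (tangentBasis A p : Mat n) (tangentBasis A q) = if p = q then 1 else 0 := by
  rw [matInner_tangent]
  simp [tangentBasis, Pi.single_apply, eq_comm]

theorem standardForm_coeff {n : ℕ} {e : OpenPartialHomeomorph (Pairs n → ℝ) (SO n)}
    (he : IsLocalParametrization e) {u : Pairs n → ℝ} (hu : u ∈ e.source) :
    (standardForm n).coeff he u = LinearMap.det (chartFrame e u) := by
  rw [TopForm.coeff, dif_pos hu, standardForm, Module.Basis.det_apply, ← LinearMap.det_toMatrix']
  congr 1

theorem isRiemannianVolumeForm_standardForm (n : ℕ) :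
    IsRiemannianVolumeForm (standardForm n) where
  smooth e he := he.contDiffOn_det_chartFrame.congr fun u hu => standardForm_coeff he hu
  orthonormal A b hb := by
    set M := (tangentBasis A).toMatrix b with hM
    have h : M.transpose * M = 1 := by
      ext p q
      rw [Matrix.one_apply, ← hb p q, matInner_tangent, Matrix.mul_apply]
      rfl
    have hdet : M.det * M.det = 1 := by
      have := congrArg Matrix.det h
      rwa [Matrix.det_mul, Matrix.det_transpose, Matrix.det_one] at this
    change |(tangentBasis A).det b| = 1
    rw [Module.Basis.det_apply]
    rcases mul_self_eq_one_iff.1 hdet with h1 | h1 <;> rw [h1] <;> simp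

theorem IsRiemannianVolumeForm.abs_coeff {n : ℕ} {ω : TopForm n} (hω : IsRiemannianVolumeForm ω)
    {e : OpenPartialHomeomorph (Pairs n → ℝ) (SO n)} (he : IsLocalParametrization e)
    {u : Pairs n → ℝ} (hu : u ∈ e.source) :
    |ω.coeff he u| = |LinearMap.det (chartFrame e u)| := by
  rw [← standardForm_coeff he hu, TopForm.coeff, TopForm.coeff, dif_pos hu, dif_pos hu,
    AlternatingMap.eq_smul_basis_det (tangentBasis (e u)) (ω (e u)), AlternatingMap.smul_apply,
    smul_eq_mul, abs_mul, hω.orthonormal _ _ (tangentBasis_orthonormal (e u)), one_mul]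
  rfl

theorem IsLocalParametrization.det_chartFrame_ne_zero {n : ℕ}
    {e : OpenPartialHomeomorph (Pairs n → ℝ) (SO n)} (he : IsLocalParametrization e)
    {u : Pairs n → ℝ} (hu : u ∈ e.source) : LinearMap.det (chartFrame e u) ≠ 0 := by
  have hker : LinearMap.ker (chartFrame e u) = ⊥ := by
    refine LinearMap.ker_eq_bot'.2 fun w hw => ?_
    have h := he.chartDeriv_eq hu w
    rw [hw, map_zero, mul_zero, chartDeriv_eq_sum] at h
    exact funext (Fintype.linearIndependent_iff.1 (he.immersion u hu) w h)
  exact (LinearEquiv.ofInjectiveEndo _ (LinearMap.ker_eq_bot.1 hker)).isUnit_det'.ne_zero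

theorem thickMeasure_ne_zero (n : ℕ) : thickMeasure n ≠ 0 := by
  intro h0
  have he := isLocalParametrization_cayleyChart (1 : SO n)
  have h := he.thickMeasure_image MeasurableSet.univ (subset_refl _)
  rw [h0, Measure.coe_zero, Pi.zero_apply, eq_comm, mul_eq_zero, or_iff_left (boxFactor_ne_zero n),
    setLIntegral_univ] at h
  refine (lintegral_pos_iff_support ?_).2 ?_ |>.ne' h
  · exact (continuousOn_univ.1 he.contDiffOn_det_chartFrame.continuousOn).abs.measurable.ennreal_ofReal
  · have : (Function.support fun u => ENNReal.ofReal
        |LinearMap.det (chartFrame (cayleyChart (1 : SO n)) u)|) = Set.univ := by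
      refine Set.eq_univ_of_forall fun u => ?_
      simpa using he.det_chartFrame_ne_zero (Set.mem_univ u)
    rw [this]
    exact isOpen_univ.measure_pos volume Set.univ_nonempty

theorem IsRiemannianVolumeForm.isMeasureOfForm {n : ℕ} {ω : TopForm n}
    (hω : IsRiemannianVolumeForm ω) :
    IsMeasureOfForm ω ((boxFactor n)⁻¹ • thickMeasure n) := by
  intro e he S hS hSe
  rw [Measure.smul_apply, smul_eq_mul, he.thickMeasure_image hS hSe, mul_comm, mul_assoc,
    ENNReal.mul_inv_cancel (boxFactor_ne_zero n) (boxFactor_ne_top n), mul_one]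
  exact setLIntegral_congr_fun hS fun u hu => by rw [hω.abs_coeff he (hSe hu)]

/-- A measure with given densities in all local coordinates is unique. -/
theorem IsMeasureOfForm.unique {n : ℕ} {ω : TopForm n} {ν ν' : Measure (SO n)}
    (h : IsMeasureOfForm ω ν) (h' : IsMeasureOfForm ω ν') : ν = ν' := by
  obtain ⟨s, hs, hcover⟩ := TopologicalSpace.countable_cover_nhds fun A : SO n =>
    (cayleyChart A).open_target.mem_nhds (mem_cayleyChart_target A)
  have : Countable s := hs.to_subtype
  rw [Set.biUnion_eq_iUnion] at hcover
  refine (Measure.ext_iff_of_iUnion_eq_univ hcover).2 fun A => Measure.ext fun S hS => ?_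
  set e := cayleyChart (A : SO n)
  rw [Measure.restrict_apply hS, Measure.restrict_apply hS]
  have hT : e '' (e ⁻¹' S) = S ∩ e.target := by
    ext B
    constructor
    · rintro ⟨u, hu, rfl⟩
      exact ⟨hu, e.map_source (Set.mem_univ u)⟩
    · rintro ⟨hB, hBt⟩
      refine ⟨e.symm B, ?_, e.right_inv hBt⟩
      rwa [Set.mem_preimage, e.right_inv hBt]
  have hm : MeasurableSet (e ⁻¹' S) :=
    (continuousOn_univ.1 e.continuousOn).measurable hS
  have hp := isLocalParametrization_cayleyChart (A : SO n)
  rw [← hT, h e hp _ hm (Set.subset_univ _), h' e hp _ hm (Set.subset_univ _)]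

end RotationGroup

end

theorem lemma2p1 (n : ℕ) (μ : MeasureTheory.Measure (RotationGroup.SO n))
    [μ.IsHaarMeasure] :
    (∃ ω : RotationGroup.TopForm n, RotationGroup.IsRiemannianVolumeForm ω) ∧
    (∀ ω : RotationGroup.TopForm n, RotationGroup.IsRiemannianVolumeForm ω →
      ∃! ν : MeasureTheory.Measure (RotationGroup.SO n), RotationGroup.IsMeasureOfForm ω ν) ∧
    ∃ C : ℝ, 0 < C ∧
      ∀ (ω : RotationGroup.TopForm n) (ν : MeasureTheory.Measure (RotationGroup.SO n)),
        RotationGroup.IsRiemannianVolumeForm ω → RotationGroup.IsMeasureOfForm ω ν →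
          ν = ENNReal.ofReal C • μ := by
  refine ⟨⟨_, RotationGroup.isRiemannianVolumeForm_standardForm n⟩,
    fun ω hω => ⟨_, hω.isMeasureOfForm, fun ν hν => hν.unique hω.isMeasureOfForm⟩, ?_⟩
  have hk := Measure.isMulInvariant_eq_smul_of_compactSpace (RotationGroup.thickMeasure n) μ
  set k := (RotationGroup.thickMeasure n).haarScalarFactor μ
  have hk0 : k ≠ 0 := fun h => RotationGroup.thickMeasure_ne_zero n (by rw [hk, h, zero_smul])
  have hc0 := RotationGroup.boxFactor_ne_zero n
  have hct := RotationGroup.boxFactor_ne_top n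
  have hpos : 0 < (RotationGroup.boxFactor n).toReal := ENNReal.toReal_pos hc0 hct
  refine ⟨(RotationGroup.boxFactor n).toReal⁻¹ * k, by positivity, fun ω ν hω hν => ?_⟩
  rw [hν.unique hω.isMeasureOfForm, hk, ENNReal.ofReal_mul (by positivity),
    ENNReal.ofReal_inv_of_pos hpos, ENNReal.ofReal_toReal hct, ENNReal.ofReal_coe_nnreal, mul_smul]
  rfl
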